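/- Let $\mathbb{F}_q$ be a finite field of characteristic $p$, $\omega=e^{2\pi i/p}$. On $\mathbb{C}^q$ with basis $\{|x\rangle : x\in\mathbb{F}_q\}$ put $X(a)|x\rangle=|x+a\rangle$, $Z(b)|x\rangle=\omega^{\mathrm{tr}_{q/p}(bx)}|x\rangle$; for $v=(a|b)\in\mathbb{F}_q^{2n}$ put $E(v)=X(a_1)Z(b_1)\otimes\cdots\otimes X(a_n)Z(b_n)$, and let $\mathcal{P}_n=\{\omega^cE(v)\}$ be the Pauli group. An $[[n,k,d]]_q$ quantum code is a $q^k$-dimensional subspace $Q\subseteq\mathbb{C}^{q^n}$ that detects all errors $E(v)$ acting nontrivially on fewer than $d$ subsystems, i.e. for each such $v$ there is $c\in\mathbb{C}$ with $\langle u,E(v)w\rangle=c\langle u,w\rangle$ for all $u,w\in Q$. It is a stabilizer code with stabilizer $S$ if $S$ is an abelian subgroup of $\mathcal{P}_n$ and $Q$ is a joint eigenspace of $S$. It is $\mathbb{F}_q$-linear if, for some such $S$, the image of $S$ in $\mathbb{F}_q^{2n}$ under $\omega^cE(v)\mapsto v$ is an $\mathbb{F}_q$-subspace; a stabilizer matrix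 is then a matrix over $\mathbb{F}_q$ whose rows form an $\mathbb{F}_q$-basis of this image. It is a CSS code if it has a stabilizer generated by elements of the forms $\omega^cE(a|0)$ and $\omega^cE(0|b)$. Let $J=[n]\cup[n]^*$ with the involution $i\leftrightarrow i^*$. A set $S\subseteq J$ is admissible if $S\cap S^*=\emptyset$. Order $J$ by $n>\cdots>1>1^*>\cdots>n^*$; for a permutation $w$ of $J$ commuting with $*$ let $i\le^w j$ iff $w^{-1}i\le w^{-1}j$, and for equal-sized subsets $A,B$ let $A\le^wB$ iff, when both are listed in $\le^w$-increasing order, $a_i\le^w b_i$ for all $i$. A symplectic matroid of rank $r$ on $J$ is a collection $\mathcal{B}$ of admissible $r$-subsets (bases) such that for every such $w$ there is a unique $B\in\mathcal{B}$ with $A\le^wB$ for all $A\in\mathcal{B}$. It is homogeneous if $|B\cap[n]|$ is the same for all $B\in\mathcal{B}$. It is represented by $M\in\mathbb{F}_q^{r\times 2n}$, with columns indexed by $J$, if the rows of $M$ are a basis of a subspace isotropic for the symplectic form $\langle(a|b),(c|d)\rangle=a\cdot d-c\cdot b$ and $\mathcal{B}$ consists of the admissible $r$-sets $B$ for which the $r\times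 r$ minor of $M$ on the columns $B$ is nonzero; it is representable over $\mathbb{F}_q$ if some such $M$ exists. **Theorem.** Let $Q$ be an $\mathbb{F}_q$-linear $[[n,k,d]]_q$ stabilizer code. Then there is a symplectic matroid $\mathcal{M}$ on $J$, representable over $\mathbb{F}_q$ and of rank $n-k$, that is induced by $Q$: every stabilizer $S$ of $Q$ has a stabilizer matrix with $n-k$ rows, and every stabilizer matrix of $S$ represents $\mathcal{M}$. If $Q$ is a CSS code, then $\mathcal{M}$ is homogeneous. -/

import Mathlib

namespace QuantumSymplectic

/-! ### Symplectic matroids -/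

/-- The ground set `J = [n] ∪ [n]*`: `Sum.inl i` is `i`, `Sum.inr i` is `i*`. -/
abbrev J (n : ℕ) : Type := Fin n ⊕ Fin n

/-- The involution `i ↦ i*`, `i* ↦ i`. -/
def invol {n : ℕ} (x : J n) : J n := x.swap

/-- `S` is admissible when `S ∩ S* = ∅`. -/
def IsAdmissible {n : ℕ} (S : Finset (J n)) : Prop :=
  Disjoint S (S.image invol)

/-- A permutation of `J` is admissible when it commutes with the involution. -/
def IsAdmissiblePerm {n : ℕ} (w : Equiv.Perm (J n)) : Prop :=
  ∀ x, w (invol x) = invol (w x)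

/-- Heights realizing the standard ordering `n > ⋯ > 2 > 1 > 1* > 2* > ⋯ > n*` of `J`. -/
def height {n : ℕ} : J n → ℤ
  | Sum.inl i => (i : ℤ) + 1
  | Sum.inr i => -((i : ℤ) + 1)

/-- `x ≤ʷ y` if and only if `w⁻¹ x ≤ w⁻¹ y` in the standard ordering. -/
def LEPerm {n : ℕ} (w : Equiv.Perm (J n)) (x y : J n) : Prop :=
  height (w⁻¹ x) ≤ height (w⁻¹ y)

/-- The strict version of `≤ʷ`. -/
def LTPerm {n : ℕ} (w : Equiv.Perm (J n)) (x y : J n) : Prop :=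
  height (w⁻¹ x) < height (w⁻¹ y)

/-- `A ≤ʷ B` for subsets of equal size: writing both increasingly with respect to `≤ʷ` as
`A = {a₁ < ⋯ < aₘ}`, `B = {b₁ < ⋯ < bₘ}`, one has `aᵢ ≤ʷ bᵢ` for all `i`. -/
def SetLE {n : ℕ} (w : Equiv.Perm (J n)) (A B : Finset (J n)) : Prop :=
  ∃ (m : ℕ) (a b : Fin m → J n),
    (∀ i j, i < j → LTPerm w (a i) (a j)) ∧ (∀ i j, i < j → LTPerm w (b i) (b j)) ∧
    Finset.univ.image a = A ∧ Finset.univ.image b = B ∧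
    ∀ i, LEPerm w (a i) (b i)

/-- A symplectic matroid on `J = [n] ∪ [n]*`, given by its bases. -/
structure SymplecticMatroid (n : ℕ) where
  rank : ℕ
  bases : Set (Finset (J n))
  admissible : ∀ B ∈ bases, IsAdmissible B
  card_eq : ∀ B ∈ bases, B.card = rank
  /-- The Maximality condition. -/
  maximality : ∀ w : Equiv.Perm (J n), IsAdmissiblePerm w →
    ∃! B, B ∈ bases ∧ ∀ A ∈ bases, SetLE w A B

/-- The number `|B ∩ [n]|` is the same for all bases `B`. -/
def SymplecticMatroid.IsHomogeneous {n : ℕ} (𝓜 : SymplecticMatroid n) : Prop :=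
  ∀ B ∈ 𝓜.bases, ∀ B' ∈ 𝓜.bases,
    (B.filter (fun x => x.isLeft)).card = (B'.filter (fun x => x.isLeft)).card

/-- The symplectic form `⟨(a|b), (c|d)⟩ = a·d - c·b` on `F²ⁿ`. -/
def sympForm {F : Type*} [Field F] {n : ℕ} (u v : J n → F) : F :=
  ∑ i, u (Sum.inl i) * v (Sum.inr i) - ∑ i, v (Sum.inl i) * u (Sum.inr i)

/-- `U` is an isotropic subspace of the symplectic space `F²ⁿ`. -/
def IsIsotropic {F : Type*} [Field F] {n : ℕ} (U : Submodule F (J n → F)) : Prop :=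
  ∀ u ∈ U, ∀ v ∈ U, sympForm u v = 0

/-- `M = [A|B]`, with columns indexed by `J` and rows a basis of an isotropic subspace of
`F²ⁿ`, represents `𝓜`: the bases of `𝓜` are the admissible sets `B` of size `r` (the number of
rows) such that the `r × r` minor of `M` on the columns indexed by `B` is nonzero. -/
def Represents {F : Type*} [Field F] {n r : ℕ} (M : Matrix (Fin r) (J n) F)
    (𝓜 : SymplecticMatroid n) : Prop :=
  LinearIndependent F M.row ∧ IsIsotropic (Submodule.span F (Set.range M.row)) ∧
  𝓜.rank = r ∧
  ∀ B : Finset (J n), B ∈ 𝓜.bases ↔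
    IsAdmissible B ∧ ∃ e : Fin r ≃ B, (M.submatrix id (fun j => (e j : J n))).det ≠ 0

/-- `𝓜` is representable over the field `F`. -/
def SymplecticMatroid.IsRepresentable {n : ℕ} (𝓜 : SymplecticMatroid n)
    (F : Type*) [Field F] : Prop :=
  ∃ (r : ℕ) (M : Matrix (Fin r) (J n) F), Represents M 𝓜

/-! ### Error operators and the Pauli group -/

section Pauli

variable (p : ℕ) [Fact p.Prime] {F : Type*} [Field F] [Fintype F] [DecidableEq F]
  [Algebra (ZMod p) F] {n : ℕ}

/-- `ω ^ c` for `c ∈ ℤ/p`, where `ω = exp (2πi / p)`. -/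
noncomputable def omegaPow (c : ZMod p) : ℂ := ZMod.stdAddChar c

/-- `X(a)|x⟩ = |x + a⟩` on `ℂ^q`, as a matrix in the basis `{|x⟩ : x ∈ F}`. -/
def opX (a : F) : Matrix F F ℂ := fun y x => if y = x + a then 1 else 0

/-- `Z(b)|x⟩ = ω^{tr(bx)}|x⟩` on `ℂ^q`. -/
noncomputable def opZ (b : F) : Matrix F F ℂ :=
  Matrix.diagonal fun x => omegaPow p (Algebra.trace (ZMod p) F (b * x))

/-- The tensor product `A₁ ⊗ ⋯ ⊗ Aₙ` of operators on `ℂ^q`, as an operator on `ℂ^{qⁿ}`; the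
basis vector `|x₁⟩ ⊗ ⋯ ⊗ |xₙ⟩` is indexed by `x : Fin n → F`. -/
def tensorOp (A : Fin n → Matrix F F ℂ) : Matrix (Fin n → F) (Fin n → F) ℂ :=
  fun y x => ∏ i, A i (y i) (x i)

/-- The error operator `X(a₁)Z(b₁) ⊗ ⋯ ⊗ X(aₙ)Z(bₙ)` of `v = (a|b) ∈ F²ⁿ`. -/
noncomputable def errorOp (v : J n → F) : Matrix (Fin n → F) (Fin n → F) ℂ :=
  tensorOp fun i => opX (v (Sum.inl i)) * opZ p (v (Sum.inr i))

theorem omegaPow_add (c d : ZMod p) : omegaPow p (c + d) = omegaPow p c * omegaPow p d :=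
  AddChar.map_add_eq_mul _ _ _

theorem omegaPow_zero : omegaPow p 0 = 1 := AddChar.map_zero_eq_one _

theorem omegaPow_sum {ι : Type*} (s : Finset ι) (f : ι → ZMod p) :
    omegaPow p (∑ i ∈ s, f i) = ∏ i ∈ s, omegaPow p (f i) :=
  by
  classical
  induction s using Finset.induction_on with
  | empty => simp [omegaPow_zero]
  | insert a s ha ih => rw [Finset.sum_insert ha, Finset.prod_insert ha, omegaPow_add, ih]

theorem opX_mul_opZ_apply (a b y x : F) : (opX a * opZ p b) y x =
    if y = x + a then omegaPow p (Algebra.trace (ZMod p) F (b * x)) else 0 := by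
  simp [opZ, opX, Matrix.mul_diagonal]

theorem errorOp_apply (v : J n → F) (y x : Fin n → F) : errorOp p v y x =
    if y = x + (fun i => v (Sum.inl i)) then
      omegaPow p (Algebra.trace (ZMod p) F (∑ i, v (Sum.inr i) * x i)) else 0 := by
  simp only [errorOp, tensorOp, opX_mul_opZ_apply]
  split_ifs with h
  · rw [map_sum, omegaPow_sum]
    refine Finset.prod_congr rfl fun i _ => ?_
    exact if_pos (congrFun h i)
  · obtain ⟨i, hi⟩ := Function.ne_iff.mp h
    exact Finset.prod_eq_zero (Finset.mem_univ i) (if_neg hi)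

theorem errorOp_zero : errorOp p (0 : J n → F) = 1 := by
  ext y x
  rw [errorOp_apply, Matrix.one_apply]
  have : (x + fun i => (0 : J n → F) (Sum.inl i)) = x := by ext i; simp
  rw [this]
  simp [omegaPow_zero]

theorem errorOp_mul (v w : J n → F) : errorOp p v * errorOp p w =
    omegaPow p (Algebra.trace (ZMod p) F (∑ i, v (Sum.inr i) * w (Sum.inl i))) •
      errorOp p (v + w) := by
  ext y x
  simp only [Matrix.mul_apply, Matrix.smul_apply, errorOp_apply, smul_eq_mul]
  rw [Finset.sum_eq_single (x + fun i => w (Sum.inl i))]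
  · have e : (x + (fun i => w (Sum.inl i))) + (fun i => v (Sum.inl i))
        = x + fun i => (v + w) (Sum.inl i) := by
      ext i; simp only [Pi.add_apply]; ring
    rw [e, if_pos rfl]
    split_ifs with h
    · rw [← omegaPow_add, ← omegaPow_add, ← map_add, ← map_add, ← Finset.sum_add_distrib,
        ← Finset.sum_add_distrib]
      congr 2
      refine Finset.sum_congr rfl fun i _ => ?_
      simp only [Pi.add_apply]; ring
    · simp
  · intro z _ hz
    rw [if_neg hz, mul_zero]
  · simp

variable (F n) in
/-- The generalized Pauli group `𝓟ₙ = {ω^c X(a₁)Z(b₁) ⊗ ⋯ ⊗ X(aₙ)Z(bₙ)}`. -/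
noncomputable def pauliGroup : Subgroup (Matrix (Fin n → F) (Fin n → F) ℂ)ˣ where
  carrier := {s | ∃ (c : ZMod p) (v : J n → F), s.val = omegaPow p c • errorOp p v}
  mul_mem' := by
    rintro s t ⟨c, v, hs⟩ ⟨d, w, ht⟩
    refine ⟨c + d + Algebra.trace (ZMod p) F (∑ i, v (Sum.inr i) * w (Sum.inl i)), v + w, ?_⟩
    rw [Units.val_mul, hs, ht, Matrix.smul_mul, Matrix.mul_smul, errorOp_mul, smul_smul,
      smul_smul, omegaPow_add, omegaPow_add, mul_assoc]
  one_mem' := ⟨0, 0, by rw [omegaPow_zero, errorOp_zero, one_smul, Units.val_one]⟩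
  inv_mem' := by
    rintro s ⟨c, v, hs⟩
    refine ⟨-c - Algebra.trace (ZMod p) F (∑ i, (-v) (Sum.inr i) * v (Sum.inl i)), -v, ?_⟩
    refine Units.inv_eq_of_mul_eq_one_left ?_
    rw [hs, Matrix.smul_mul, Matrix.mul_smul, errorOp_mul, smul_smul, smul_smul,
      neg_add_cancel, errorOp_zero, ← omegaPow_add, ← omegaPow_add]
    rw [show ∀ t : ZMod p, -c - t + c + t = 0 from fun t => by ring, omegaPow_zero, one_smul]

/-! ### Quantum codes

The state space `ℂ^{qⁿ}` is `(Fin n → F) → ℂ` with the standard Hermitian inner product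
`⟨u, v⟩ = star u ⬝ᵥ v`. -/

/-- The number of subsystems on which the error operator of `v` acts nontrivially. -/
def weight (v : J n → F) : ℕ :=
  (Finset.univ.filter fun i => v (Sum.inl i) ≠ 0 ∨ v (Sum.inr i) ≠ 0).card

/-- The code `Q` detects the error `E`: compressing `E` to `Q` gives a scalar. -/
def Detects (Q : Submodule ℂ ((Fin n → F) → ℂ)) (E : Matrix (Fin n → F) (Fin n → F) ℂ) : Prop :=
  ∃ c : ℂ, ∀ u ∈ Q, ∀ v ∈ Q,
    dotProduct (star u) (E.mulVec v) = c * dotProduct (star u) v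

/-- `Q` is an `[[n,k,d]]_q` quantum code: a `q^k`-dimensional subspace of `ℂ^{qⁿ}` able to detect
all errors on fewer than `d` subsystems. -/
def IsQuantumCode (k d : ℕ) (Q : Submodule ℂ ((Fin n → F) → ℂ)) : Prop :=
  Module.finrank ℂ Q = Fintype.card F ^ k ∧
  ∀ v : J n → F, weight v < d → Detects Q (errorOp p v)

/-- `Q` is a stabilizer code with stabilizer `S`: `S` is an abelian subgroup of the Pauli group
and `Q` is a joint eigenspace of `S` (most often all the eigenvalues `ev s` are taken to be `1`). -/
def IsStabilizer (S : Subgroup (Matrix (Fin n → F) (Fin n → F) ℂ)ˣ)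
    (Q : Submodule ℂ ((Fin n → F) → ℂ)) : Prop :=
  S ≤ pauliGroup p F n ∧ (∀ s ∈ S, ∀ t ∈ S, s * t = t * s) ∧
  ∃ ev : (Matrix (Fin n → F) (Fin n → F) ℂ)ˣ → ℂ,
    ∀ v, v ∈ Q ↔ ∀ s ∈ S, s.val.mulVec v = ev s • v

/-- The image of `S` in `F²ⁿ` under `ω^c X(a₁)Z(b₁) ⊗ ⋯ ⊗ X(aₙ)Z(bₙ) ↦ (a|b)`. -/
def stabImage (S : Subgroup (Matrix (Fin n → F) (Fin n → F) ℂ)ˣ) : Set (J n → F) :=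
  {v | ∃ s ∈ S, ∃ c : ZMod p, s.val = omegaPow p c • errorOp p v}

/-- `Q` is an `F`-linear stabilizer code: it has a stabilizer whose image in `F²ⁿ` is an
`F`-linear subspace. -/
def IsLinearStabilizerCode (Q : Submodule ℂ ((Fin n → F) → ℂ)) : Prop :=
  ∃ S, IsStabilizer p S Q ∧ ∃ C : Submodule F (J n → F), (C : Set (J n → F)) = stabImage p S

/-- `M` is a stabilizer matrix for `S`: its rows form an `F`-basis of the image of `S`. -/
def IsStabilizerMatrix (S : Subgroup (Matrix (Fin n → F) (Fin n → F) ℂ)ˣ) {r : ℕ}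
    (M : Matrix (Fin r) (J n) F) : Prop :=
  LinearIndependent F M.row ∧
  (Submodule.span F (Set.range M.row) : Set (J n → F)) = stabImage p S

/-- `Q` is a CSS code: it has a stabilizer generated by operators each of which is, up to a
phase, purely of the form `X(a₁) ⊗ ⋯ ⊗ X(aₙ)` or purely of the form `Z(b₁) ⊗ ⋯ ⊗ Z(bₙ)`. -/
def IsCSSCode (Q : Submodule ℂ ((Fin n → F) → ℂ)) : Prop :=
  ∃ S, IsStabilizer p S Q ∧
    S = Subgroup.closure {s | s ∈ S ∧ ∃ (c : ZMod p) (v : J n → F),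
      s.val = omegaPow p c • errorOp p v ∧
      ((∀ i, v (Sum.inr i) = 0) ∨ (∀ i, v (Sum.inl i) = 0))}

end Pauli

end QuantumSymplectic

namespace QuantumSymplectic

/-! ### The orderings `≤ʷ` -/

/-! Everything reduces to one subspace that depends on `Q` alone. Let `scalarGroup` be the set of
`v` for which `E(v)` acts on `Q` as a scalar; it contains the image of every stabilizer. If `C` is
an additive group between that image and `scalarGroup`, then `Q` is the joint eigenspace of `C`, and
averaging the normalized operators `E(v)`, `v ∈ C`, gives a projection onto `Q`. Only `v = 0`
contributes to its trace, so `dim Q * |C| = q^n` (`IsStabilizer.finrank_mul_card`). All such `C`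
have the same size, so the image of every stabilizer equals `scalarGroup`
(`IsStabilizer.stabImage_eq`). Under `F`-linearity this is a subspace `U` of dimension `n - k`. It
is isotropic because the operators commute on `Q` and the trace form is nondegenerate.

The admissible information sets of an isotropic `U` form a symplectic matroid. For each `w` the
maximal basis is the set of pivots of `U` for `≤ʷ`: dimension counts give maximality
(`setLE_leadingSet`), and isotropy prevents `i` and `i*` from both being pivots
(`isAdmissible_leadingSet`). Minors detect information sets (`det_submatrix_ne_zero_iff`), so every
matrix with row space `U` represents this matroid. For a CSS code `U` contains the `X`-parts of its
vectors, which forces `|B ∩ [n]|` to be the dimension of the `X`-projection of `U`. -/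

lemma height_injective {n : ℕ} : Function.Injective (height (n := n)) := by
  rintro (i | i) (j | j) h <;> simp only [height] at h
  · exact congrArg Sum.inl (Fin.ext (by omega))
  · omega
  · omega
  · exact congrArg Sum.inr (Fin.ext (by omega))

lemma height_invol {n : ℕ} (x : J n) : height (invol x) = -height x := by
  rcases x with i | i <;> simp [height, invol]

/-- The height function realizing `≤ʷ`. -/
def heightPerm {n : ℕ} (w : Equiv.Perm (J n)) (x : J n) : ℤ := height (w⁻¹ x)

lemma heightPerm_injective {n : ℕ} (w : Equiv.Perm (J n)) :
    Function.Injective (heightPerm w) :=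
  height_injective.comp (w⁻¹).injective

lemma IsAdmissiblePerm.heightPerm_invol {n : ℕ} {w : Equiv.Perm (J n)}
    (hw : IsAdmissiblePerm w) (x : J n) : heightPerm w (invol x) = -heightPerm w x := by
  have h : w⁻¹ (invol x) = invol (w⁻¹ x) := by
    rw [Equiv.Perm.inv_eq_iff_eq, hw, ← Equiv.Perm.mul_apply, mul_inv_cancel, Equiv.Perm.one_apply]
  rw [heightPerm, h, height_invol, heightPerm]

/-- A finite set listed increasingly with respect to an injective height function. -/
lemma exists_increasing_listing {α : Type*} [DecidableEq α] {κ : α → ℤ}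
    (hκ : Function.Injective κ) (A : Finset α) {m : ℕ} (hA : A.card = m) :
    ∃ a : Fin m → α, (∀ i j, i < j → κ (a i) < κ (a j)) ∧ Finset.univ.image a = A := by
  have hc : (A.image κ).card = m := by rw [Finset.card_image_of_injective _ hκ, hA]
  have hmem (i : Fin m) : ∃ x ∈ A, κ x = (A.image κ).orderEmbOfFin hc i :=
    Finset.mem_image.mp (Finset.orderEmbOfFin_mem _ hc i)
  choose a haA ha using hmem
  have hlt : ∀ i j, i < j → κ (a i) < κ (a j) := fun i j hij => by
    rw [ha, ha]; exact (OrderEmbedding.lt_iff_lt _).mpr hij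
  refine ⟨a, hlt, Finset.eq_of_subset_of_card_le ?_ ?_⟩
  · intro x hx
    obtain ⟨i, -, rfl⟩ := Finset.mem_image.mp hx
    exact haA i
  · have hinj : Function.Injective a := fun i j hij => by
      rcases lt_trichotomy i j with h | h | h
      · exact absurd (congrArg κ hij) (hlt i j h).ne
      · exact h
      · exact absurd (congrArg κ hij) (hlt j i h).ne'
    rw [Finset.card_image_of_injective _ hinj, Finset.card_univ, Fintype.card_fin, hA]

/-- If `b i` were below `a i`, then at the threshold given by the height of `a i` the set `B` would
have at least `i + 1` elements below it, and `A` at most `i`. -/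
lemma setLE_of_card_filter_le {n : ℕ} (w : Equiv.Perm (J n)) {A B : Finset (J n)}
    (hcard : A.card = B.card)
    (h : ∀ t : ℤ, (B.filter (fun x => heightPerm w x < t)).card ≤
      (A.filter (fun x => heightPerm w x < t)).card) : SetLE w A B := by
  obtain ⟨a, ha, haA⟩ := exists_increasing_listing (heightPerm_injective w) A hcard
  obtain ⟨b, hb, hbB⟩ := exists_increasing_listing (heightPerm_injective w) B rfl
  refine ⟨B.card, a, b, ha, hb, haA, hbB, fun i => ?_⟩
  by_contra hlt
  replace hlt : heightPerm w (b i) < heightPerm w (a i) := not_le.mp hlt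
  have hbinj : Function.Injective b := fun i j hij => by
    rcases lt_trichotomy i j with h | h | h
    · exact absurd (congrArg (heightPerm w) hij) (hb i j h).ne
    · exact h
    · exact absurd (congrArg (heightPerm w) hij) (hb j i h).ne'
  have h1 : (Finset.Iic i).image b ⊆ B.filter (fun x => heightPerm w x < heightPerm w (a i)) := by
    intro x hx
    obtain ⟨j, hj, rfl⟩ := Finset.mem_image.mp hx
    refine Finset.mem_filter.mpr ⟨hbB ▸ Finset.mem_image_of_mem b (Finset.mem_univ j), ?_⟩
    rcases (Finset.mem_Iic.mp hj).eq_or_lt with rfl | hji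
    · exact hlt
    · exact (hb j i hji).trans hlt
  have h2 : A.filter (fun x => heightPerm w x < heightPerm w (a i)) ⊆ (Finset.Iio i).image a := by
    intro x hx
    obtain ⟨hxA, hx⟩ := Finset.mem_filter.mp hx
    rw [← haA] at hxA
    obtain ⟨j, -, rfl⟩ := Finset.mem_image.mp hxA
    refine Finset.mem_image_of_mem a (Finset.mem_Iio.mpr ?_)
    by_contra hij
    rcases (not_lt.mp hij).eq_or_lt with rfl | hij
    · exact lt_irrefl _ hx
    · exact lt_asymm hx (ha i j hij)
  have h3 := (Finset.card_le_card h1).trans ((h _).trans (Finset.card_le_card h2))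
  rw [Finset.card_image_of_injective _ hbinj, Fin.card_Iic] at h3
  have h4 := h3.trans Finset.card_image_le
  rw [Fin.card_Iio] at h4
  omega

/-- The total height is a strictly monotone invariant of the order, so antisymmetry follows without
comparing the different listings that `SetLE` may provide. -/
lemma SetLE.sum_le {n : ℕ} {w : Equiv.Perm (J n)} {A B : Finset (J n)} (h : SetLE w A B) :
    ∑ x ∈ A, heightPerm w x ≤ ∑ x ∈ B, heightPerm w x ∧
      (∑ x ∈ A, heightPerm w x = ∑ x ∈ B, heightPerm w x → A = B) := by
  obtain ⟨m, a, b, ha, hb, rfl, rfl, hab⟩ := h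
  have inj {a : Fin m → J n} (ha : ∀ i j, i < j → LTPerm w (a i) (a j)) :
      Function.Injective a := fun i j hij => by
    rcases lt_trichotomy i j with h | h | h
    · exact absurd (congrArg (heightPerm w) hij) (ha i j h).ne
    · exact h
    · exact absurd (congrArg (heightPerm w) hij) (ha j i h).ne'
  rw [Finset.sum_image (inj ha).injOn, Finset.sum_image (inj hb).injOn]
  refine ⟨Finset.sum_le_sum fun i _ => hab i, fun h => ?_⟩
  have h' := (Finset.sum_eq_sum_iff_of_le fun i _ => hab i).mp h
  rw [funext fun i => heightPerm_injective w (h' i (Finset.mem_univ i))]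

lemma SetLE.antisymm {n : ℕ} {w : Equiv.Perm (J n)} {A B : Finset (J n)} (h : SetLE w A B)
    (h' : SetLE w B A) : A = B :=
  h.sum_le.2 (le_antisymm h.sum_le.1 h'.sum_le.1)

/-! ### The symplectic matroid of an isotropic subspace -/

section Isotropic

variable {F : Type*} [Field F] {n : ℕ}

/-- `B` is an information set of `U`: restriction of coordinates identifies `U` with `F^B`. -/
def IsInfoSet (U : Submodule F (J n → F)) (B : Finset (J n)) : Prop :=
  B.card = Module.finrank F U ∧ ∀ u ∈ U, (∀ j ∈ B, u j = 0) → u = 0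

/-- A subspace on which the coordinates in `B` separate points has dimension at most `|B|`. -/
lemma finrank_le_card {ι : Type*} [Fintype ι] (U : Submodule F (ι → F)) (B : Finset ι)
    (h : ∀ u ∈ U, (∀ j ∈ B, u j = 0) → u = 0) : Module.finrank F U ≤ B.card := by
  let f : U →ₗ[F] (B → F) := (LinearMap.funLeft F F ((↑) : B → ι)).comp U.subtype
  have hf : Function.Injective f := by
    rw [← LinearMap.ker_eq_bot, LinearMap.ker_eq_bot']
    intro u hu
    exact Subtype.ext (h u u.2 fun j hj => congrFun hu ⟨j, hj⟩)
  simpa using LinearMap.finrank_le_finrank_of_injective hf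

/-! ### Leading positions (pivots) with respect to a height function -/

/-- `j` is a leading position of `U` for `κ`: some vector of `U` is nonzero at `j` and vanishes
at all larger positions. -/
def IsLeading {ι : Type*} (κ : ι → ℤ) (U : Submodule F (ι → F)) (j : ι) : Prop :=
  ∃ u ∈ U, u j ≠ 0 ∧ ∀ i, κ j < κ i → u i = 0

open Classical in
/-- The set of leading positions of `U` for `κ`. -/
noncomputable def leadingSet {ι : Type*} [Fintype ι] (κ : ι → ℤ) (U : Submodule F (ι → F)) :
    Finset ι :=
  Finset.univ.filter (IsLeading κ U)

lemma mem_leadingSet {ι : Type*} [Fintype ι] {κ : ι → ℤ} {U : Submodule F (ι → F)} {j : ι} :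
    j ∈ leadingSet κ U ↔ IsLeading κ U j := by
  simp [leadingSet]

/-- The highest position in the support of a nonzero vector of `U` is a leading position. -/
lemma eq_zero_of_leadingSet {ι : Type*} [Fintype ι] {κ : ι → ℤ} {U : Submodule F (ι → F)}
    {u : ι → F} (hu : u ∈ U)
    (h : ∀ j ∈ leadingSet κ U, u j = 0) : u = 0 := by
  classical
  by_contra hne
  obtain ⟨j0, hj0⟩ := Function.ne_iff.mp hne
  obtain ⟨j, hj, hmax⟩ := (Finset.univ.filter fun j => u j ≠ 0).exists_max_image κ
    ⟨j0, by simpa using hj0⟩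
  have hj : u j ≠ 0 := by simpa using hj
  refine hj (h j (mem_leadingSet.mpr ⟨u, hu, hj, fun i hi => ?_⟩))
  by_contra hui
  exact absurd (hmax i (by simpa using hui)) (not_le.mpr hi)

/-- The subspace of the vectors of `U` supported on positions of height less than `t`. -/
def truncate {ι : Type*} (κ : ι → ℤ) (U : Submodule F (ι → F)) (t : ℤ) :
    Submodule F (ι → F) where
  carrier := {u | u ∈ U ∧ ∀ i, t ≤ κ i → u i = 0}
  zero_mem' := ⟨U.zero_mem, fun _ _ => rfl⟩
  add_mem' := fun ha hb => ⟨U.add_mem ha.1 hb.1, fun i hi => by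
    rw [Pi.add_apply, ha.2 i hi, hb.2 i hi, add_zero]⟩
  smul_mem' := fun c _ ha => ⟨U.smul_mem c ha.1, fun i hi => by
    rw [Pi.smul_apply, ha.2 i hi, smul_zero]⟩

/-- Vectors with distinct leading positions are independent, as in an echelon form, and those
leading below `t` lie in the truncation at `t`. -/
lemma card_leadingSet_le_finrank {ι : Type*} [Fintype ι] {κ : ι → ℤ}
    (hκ : Function.Injective κ) (U : Submodule F (ι → F)) (t : ℤ) :
    ((leadingSet κ U).filter (fun x => κ x < t)).card ≤
      Module.finrank F (truncate κ U t) := by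
  classical
  have hlead (j : (leadingSet κ U).filter (fun x => κ x < t)) : IsLeading κ U j :=
    mem_leadingSet.mp (Finset.mem_filter.mp j.2).1
  choose u huU hu0 hu using hlead
  let v : (leadingSet κ U).filter (fun x => κ x < t) → truncate κ U t := fun j =>
    ⟨u j, huU j, fun i hi => hu j i (lt_of_lt_of_le (Finset.mem_filter.mp j.2).2 hi)⟩
  have hv : LinearIndependent F v := by
    rw [Fintype.linearIndependent_iff]
    intro g hg
    by_contra! hne
    obtain ⟨j0, hj0⟩ := hne
    -- In a linear relation, evaluate at the highest `j` with nonzero coefficient: the other vectors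
    -- that occur lead lower and vanish there.
    obtain ⟨j, hj, hmax⟩ := (Finset.univ.filter fun j => g j ≠ 0).exists_max_image
      (fun j => κ j) ⟨j0, by simpa using hj0⟩
    have hj : g j ≠ 0 := by simpa using hj
    have h := congrFun (congrArg Subtype.val hg) (j : ι)
    simp only [Submodule.coe_sum, Submodule.coe_smul, Finset.sum_apply, Pi.smul_apply,
      smul_eq_mul, v, ZeroMemClass.coe_zero, Pi.zero_apply] at h
    rw [Finset.sum_eq_single j] at h
    · exact mul_ne_zero hj (hu0 j) h
    · intro i _ hij
      by_cases hgi : g i = 0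
      · rw [hgi, zero_mul]
      · have hle := hmax i (by simpa using hgi)
        have hlt : κ i < κ j := lt_of_le_of_ne hle fun h => hij (Subtype.ext (hκ h))
        rw [hu i j hlt, mul_zero]
    · simp
  simpa only [Fintype.card_coe] using hv.fintype_card_le_finrank

lemma card_leadingSet {ι : Type*} [Fintype ι] {κ : ι → ℤ} (hκ : Function.Injective κ)
    (U : Submodule F (ι → F)) : (leadingSet κ U).card = Module.finrank F U := by
  classical
  refine le_antisymm ?_ (finrank_le_card U _ fun u hu => eq_zero_of_leadingSet hu)
  obtain ⟨t, ht⟩ : ∃ t, ∀ i, κ i < t := by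
    obtain ⟨M, hM⟩ := (Set.finite_range κ).bddAbove
    exact ⟨M + 1, fun i => Int.lt_add_one_of_le (hM ⟨i, rfl⟩)⟩
  have h := card_leadingSet_le_finrank hκ U t
  rw [Finset.filter_true_of_mem fun i _ => ht i] at h
  exact h.trans (Submodule.finrank_mono fun u hu => hu.1)

/-- For each `t`, the number of pivots below `t` is at most the dimension of the truncation. The
latter is at most the number of elements of `A` below `t`, since these coordinates already separate
the truncated vectors. -/
lemma setLE_leadingSet (w : Equiv.Perm (J n)) {U : Submodule F (J n → F)} {A : Finset (J n)}
    (hA : IsInfoSet U A) : SetLE w A (leadingSet (heightPerm w) U) := by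
  have hκ := heightPerm_injective w
  refine setLE_of_card_filter_le w (hA.1.trans (card_leadingSet hκ U).symm) fun t => ?_
  refine (card_leadingSet_le_finrank hκ U t).trans (finrank_le_card _ _ fun u hu h => ?_)
  refine hA.2 u hu.1 fun j hj => ?_
  by_cases hjt : heightPerm w j < t
  · exact h j (Finset.mem_filter.mpr ⟨hj, hjt⟩)
  · exact hu.2 j (not_lt.mp hjt)

/-- Every term of the form is, up to sign, `u j * v (invol j)`. Above `i` the factor `u j` vanishes;
below `i` the position `invol j` is above `i*`, so the other factor vanishes. Only the term at `i`
survives. -/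
lemma sympForm_ne_zero_of_leading {κ : J n → ℤ} (hκ : Function.Injective κ)
    (hinv : ∀ x, κ (invol x) = -κ x) {i : Fin n} {u v : J n → F}
    (hu : u (Sum.inl i) ≠ 0) (hu' : ∀ j, κ (Sum.inl i) < κ j → u j = 0)
    (hv : v (Sum.inr i) ≠ 0) (hv' : ∀ j, κ (Sum.inr i) < κ j → v j = 0) :
    sympForm u v ≠ 0 := by
  have hi : κ (Sum.inr i) = -κ (Sum.inl i) := hinv (Sum.inl i)
  have hl (j : J n) (hj : j ≠ Sum.inl i) : u j * v (invol j) = 0 := by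
    rcases lt_trichotomy (κ (Sum.inl i)) (κ j) with h | h | h
    · rw [hu' j h, zero_mul]
    · exact absurd (hκ h).symm hj
    · rw [hv' (invol j) (by rw [hi, hinv]; omega), mul_zero]
  rw [sympForm, Finset.sum_eq_single (f := fun j => u (Sum.inl j) * v (Sum.inr j)) i
    (fun j _ hj => hl (Sum.inl j) (fun h => hj (Sum.inl_injective h))) (by simp),
    Finset.sum_eq_zero (s := Finset.univ) (f := fun j => v (Sum.inl j) * u (Sum.inr j))
    (fun j _ => by rw [mul_comm]; exact hl (Sum.inr j) (by simp)), sub_zero]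
  exact mul_ne_zero hu hv

lemma isAdmissible_leadingSet {U : Submodule F (J n → F)} (hU : IsIsotropic U)
    {w : Equiv.Perm (J n)} (hw : IsAdmissiblePerm w) :
    IsAdmissible (leadingSet (heightPerm w) U) := by
  have key (i : Fin n) (hl : IsLeading (heightPerm w) U (Sum.inl i))
      (hr : IsLeading (heightPerm w) U (Sum.inr i)) : False := by
    obtain ⟨u, hu, hu0, hu'⟩ := hl
    obtain ⟨v, hv, hv0, hv'⟩ := hr
    exact sympForm_ne_zero_of_leading (heightPerm_injective w) hw.heightPerm_invol hu0 hu' hv0 hv'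
      (hU u hu v hv)
  rw [IsAdmissible, Finset.disjoint_left]
  intro x hx hx'
  obtain ⟨y, hy, rfl⟩ := Finset.mem_image.mp hx'
  rw [mem_leadingSet] at hx hy
  rcases y with i | i
  · exact key i hy hx
  · exact key i hx hy

/-- The symplectic matroid of an isotropic subspace. -/
noncomputable def SymplecticMatroid.ofIsotropic (U : Submodule F (J n → F))
    (hU : IsIsotropic U) : SymplecticMatroid n where
  rank := Module.finrank F U
  bases := {B | IsAdmissible B ∧ IsInfoSet U B}
  admissible := fun _ hB => hB.1
  card_eq := fun _ hB => hB.2.1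
  maximality := fun w hw => by
    have hκ := heightPerm_injective w
    have hB : IsAdmissible (leadingSet (heightPerm w) U) ∧
        IsInfoSet U (leadingSet (heightPerm w) U) :=
      ⟨isAdmissible_leadingSet hU hw, card_leadingSet hκ U,
        fun u hu => eq_zero_of_leadingSet hu⟩
    exact ⟨_, ⟨hB, fun A hA => setLE_leadingSet w hA.2⟩,
      fun B' hB' => (setLE_leadingSet w hB'.1.2).antisymm (hB'.2 _ hB)⟩

/-! ### Minors, information sets and homogeneity -/

/-- A vanishing minor is a nonzero row combination that is zero on `B`; by independence of the rows
the combination itself is a nonzero vector of the row space. -/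
lemma det_submatrix_ne_zero_iff {r : ℕ} {M : Matrix (Fin r) (J n) F}
    (hM : LinearIndependent F M.row) {B : Finset (J n)} (e : Fin r ≃ B) :
    (M.submatrix id (fun j => (e j : J n))).det ≠ 0 ↔
      ∀ u ∈ Submodule.span F (Set.range M.row), (∀ j ∈ B, u j = 0) → u = 0 := by
  have hspan (u : J n → F) :
      u ∈ Submodule.span F (Set.range M.row) ↔ ∃ x, Matrix.vecMul x M = u := by
    rw [Submodule.mem_span_range_iff_exists_fun]
    simp only [Matrix.vecMul_eq_sum]
    rfl
  rw [ne_eq, ← Matrix.exists_vecMul_eq_zero_iff]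
  constructor
  · intro h u hu huB
    obtain ⟨x, rfl⟩ := (hspan u).mp hu
    by_contra hne
    refine h ⟨x, ?_, ?_⟩
    · rintro rfl
      exact hne (Matrix.zero_vecMul M)
    · ext j
      exact huB (e j) (e j).2
  · rintro h ⟨x, hx, hx0⟩
    refine hx (Matrix.vecMul_injective_iff.mpr hM ?_)
    change Matrix.vecMul x M = Matrix.vecMul 0 M
    rw [Matrix.zero_vecMul]
    refine h _ ((hspan _).mpr ⟨x, rfl⟩) fun j hj => ?_
    have := congrFun hx0 (e.symm ⟨j, hj⟩)
    simpa [Matrix.vecMul, dotProduct] using this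

lemma represents_ofIsotropic {r : ℕ} {M : Matrix (Fin r) (J n) F}
    (hM : LinearIndependent F M.row) {U : Submodule F (J n → F)} (hU : IsIsotropic U)
    (hspan : Submodule.span F (Set.range M.row) = U) :
    Represents M (SymplecticMatroid.ofIsotropic U hU) := by
  have hr : Module.finrank F U = r := by
    rw [← hspan, finrank_span_eq_card hM, Fintype.card_fin]
  refine ⟨hM, hspan ▸ hU, hr, fun B => and_congr_right fun _ => ?_⟩
  constructor
  · rintro ⟨hc, h⟩
    let e : Fin r ≃ B := (Fintype.equivFinOfCardEq (by simp [hc, hr])).symm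
    exact ⟨e, (det_submatrix_ne_zero_iff hM e).mpr (hspan ▸ h)⟩
  · rintro ⟨e, he⟩
    refine ⟨?_, hspan ▸ (det_submatrix_ne_zero_iff hM e).mp he⟩
    rw [hr]
    simpa using (Fintype.card_congr e).symm

/-- The `X`-part `(a|0)` of `(a|b)`. -/
def xPart : (J n → F) →ₗ[F] (J n → F) where
  toFun u := Sum.elim (fun i => u (Sum.inl i)) (fun _ => 0)
  map_add' u v := by ext (i | i) <;> simp
  map_smul' c u := by ext (i | i) <;> simp

/-- A subspace that is the sum of its `X`-part and its `Z`-part has a homogeneous matroid. -/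
lemma isHomogeneous_ofIsotropic {U : Submodule F (J n → F)} (hU : IsIsotropic U)
    (h : ∀ u ∈ U, xPart u ∈ U) :
    (SymplecticMatroid.ofIsotropic U hU).IsHomogeneous := by
  let f : U →ₗ[F] (J n → F) := xPart.comp U.subtype
  have hdim := LinearMap.finrank_range_add_finrank_ker f
  have key (B : Finset (J n)) (hB : IsInfoSet U B) :
      (B.filter (fun x => x.isLeft)).card = Module.finrank F (LinearMap.range f) := by
    -- The range of `f` lies in `U` and is supported on `[n]`, while the kernel is supported on
    -- `[n]*`. So the two halves of `B` separate the range and the kernel respectively. The two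
    -- bounds add up to `|B| = dim U` by rank-nullity, so both are equalities.
    have h1 : Module.finrank F (LinearMap.range f) ≤ (B.filter (fun x => x.isLeft)).card := by
      refine finrank_le_card _ _ ?_
      rintro _ ⟨u, rfl⟩ hu
      refine hB.2 _ (h u u.2) ?_
      rintro (i | i) hi
      · exact hu _ (Finset.mem_filter.mpr ⟨hi, rfl⟩)
      · rfl
    have h2 : Module.finrank F (LinearMap.ker f) ≤
        (B.filter (fun x => ¬ x.isLeft)).card := by
      have hmap : Module.finrank F ((LinearMap.ker f).map U.subtype) =
          Module.finrank F (LinearMap.ker f) :=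
        LinearEquiv.finrank_eq
          (Submodule.equivMapOfInjective _ U.injective_subtype _).symm
      rw [← hmap]
      refine finrank_le_card _ _ ?_
      rintro _ ⟨u, hu, rfl⟩ huB
      refine hB.2 _ u.2 ?_
      rintro (i | i) hi
      · exact congrFun (LinearMap.mem_ker.mp hu) (Sum.inl i)
      · exact huB _ (Finset.mem_filter.mpr ⟨hi, by simp⟩)
    have h3 := Finset.card_filter_add_card_filter_not (s := B) (fun x => x.isLeft = true)
    have h4 := hB.1
    omega
  intro B hB B' hB'
  rw [key B hB.2, key B' hB'.2]

end Isotropic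

/-! ### Stabilizer codes -/

section Stabilizer

variable (p : ℕ) [Fact p.Prime] {F : Type*} [Field F] [Fintype F] [DecidableEq F]
  [Algebra (ZMod p) F] {n : ℕ}

/-! ### Traces of error operators and dimensions of joint eigenspaces -/

omit [DecidableEq F] in
lemma exists_trace_mul_ne_zero {a : F} (ha : a ≠ 0) :
    ∃ b : F, Algebra.trace (ZMod p) F (a * b) ≠ 0 := by
  have htr := (traceForm_nondegenerate (ZMod p) F).1 a
  simp_rw [Algebra.traceForm_apply] at htr
  by_contra! hf
  exact ha (htr hf)

lemma omegaPow_injective : Function.Injective (omegaPow p) := ZMod.injective_stdAddChar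

lemma omegaPow_ne_zero (c : ZMod p) : omegaPow p c ≠ 0 := fun h => by
  have := omegaPow_add p c (-c)
  rw [add_neg_cancel, omegaPow_zero, h, zero_mul] at this
  exact one_ne_zero this

/-- A nonzero `X`-part leaves no diagonal entries. Otherwise the trace is the sum of a nontrivial
additive character over `F^n`. -/
lemma trace_errorOp {v : J n → F} (hv : v ≠ 0) : (errorOp p v).trace = 0 := by
  simp only [Matrix.trace, Matrix.diag_apply, errorOp_apply, left_eq_add]
  split_ifs with ha
  · obtain ⟨i, hi⟩ : ∃ i, v (Sum.inr i) ≠ 0 := by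
      by_contra! h
      exact hv (funext fun j => j.rec (fun i => congrFun ha i) h)
    obtain ⟨b, hb⟩ := exists_trace_mul_ne_zero p hi
    let f : (Fin n → F) →+ ZMod p := (Algebra.trace (ZMod p) F).toAddMonoidHom.comp
      { toFun := fun x => ∑ i, v (Sum.inr i) * x i
        map_zero' := by simp
        map_add' := fun x y => by simp [mul_add, Finset.sum_add_distrib] }
    refine AddChar.sum_eq_zero_of_ne_one (ψ := ZMod.stdAddChar.compAddMonoidHom f) ?_
    refine AddChar.ne_one_iff.mpr ⟨Pi.single i b, fun h => hb (omegaPow_injective p ?_)⟩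
    rw [omegaPow_zero]
    simpa [f, omegaPow, Pi.single_apply] using h
  · exact Finset.sum_const_zero

lemma trace_errorOp_zero :
    (errorOp p (0 : J n → F)).trace = (Fintype.card F : ℂ) ^ n := by
  rw [errorOp_zero, Matrix.trace_one]
  simp

/-- The phase in `E(v) E(w) = φ(v, w) E(v + w)`. -/
noncomputable def cocycle (v w : J n → F) : ℂ :=
  omegaPow p (Algebra.trace (ZMod p) F (∑ i, v (Sum.inr i) * w (Sum.inl i)))

omit [Fintype F] [DecidableEq F] in
lemma cocycle_ne_zero (v w : J n → F) : cocycle p v w ≠ 0 := omegaPow_ne_zero p _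

lemma errorOp_mulVec_mulVec (v w : J n → F) (u : (Fin n → F) → ℂ) :
    (errorOp p v).mulVec ((errorOp p w).mulVec u) =
      cocycle p v w • (errorOp p (v + w)).mulVec u := by
  rw [Matrix.mulVec_mulVec, errorOp_mul, Matrix.smul_mulVec]; rfl

lemma eigenvalue_ne_zero {v : J n → F} {u : (Fin n → F) → ℂ} (hu : u ≠ 0) {c : ℂ}
    (h : (errorOp p v).mulVec u = c • u) : c ≠ 0 := by
  rintro rfl
  have h' := errorOp_mulVec_mulVec p (-v) v u
  rw [h, zero_smul, Matrix.mulVec_zero, neg_add_cancel, errorOp_zero, Matrix.one_mulVec] at h'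
  exact (smul_ne_zero (cocycle_ne_zero p _ _) hu) h'.symm

/-- The `v` for which `E(v)` acts on `Q` as a scalar. -/
noncomputable def scalarGroup (Q : Submodule ℂ ((Fin n → F) → ℂ)) : AddSubgroup (J n → F) where
  carrier := {v | ∃ c : ℂ, ∀ u ∈ Q, (errorOp p v).mulVec u = c • u}
  zero_mem' := ⟨1, fun u _ => by rw [errorOp_zero, Matrix.one_mulVec, one_smul]⟩
  add_mem' := by
    rintro v w ⟨c, hc⟩ ⟨d, hd⟩
    refine ⟨(cocycle p v w)⁻¹ * (d * c), fun u hu => ?_⟩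
    have h := errorOp_mulVec_mulVec p v w u
    rw [hd u hu, Matrix.mulVec_smul, hc u hu, smul_smul] at h
    rw [mul_smul, h, smul_smul, inv_mul_cancel₀ (cocycle_ne_zero p v w), one_smul]
  neg_mem' := by
    rintro v ⟨c, hc⟩
    refine ⟨c⁻¹ * cocycle p (-v) v, fun u hu => ?_⟩
    by_cases hu0 : u = 0
    · rw [hu0, Matrix.mulVec_zero, smul_zero]
    have h := errorOp_mulVec_mulVec p (-v) v u
    rw [hc u hu, Matrix.mulVec_smul, neg_add_cancel, errorOp_zero, Matrix.one_mulVec] at h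
    rw [mul_smul, ← h, smul_smul, inv_mul_cancel₀ (eigenvalue_ne_zero p hu0 (hc u hu)), one_smul]

/-- The dimension of a joint eigenspace of a group of error operators. -/
lemma finrank_mul_card {Q : Submodule ℂ ((Fin n → F) → ℂ)} (hQ : Q ≠ ⊥)
    (C : AddSubgroup (J n → F)) (ev : (J n → F) → ℂ)
    (h : ∀ u, u ∈ Q ↔ ∀ v ∈ C, (errorOp p v).mulVec u = ev v • u) :
    Module.finrank ℂ Q * Nat.card C = Fintype.card F ^ n := by
  classical
  obtain ⟨u₀, hu₀, hne⟩ := Submodule.exists_mem_ne_zero_of_ne_bot hQ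
  have h₀ := (h u₀).mp hu₀
  have hev (v) (hv : v ∈ C) : ev v ≠ 0 := eigenvalue_ne_zero p hne (h₀ v hv)
  -- Comparing eigenvalues on `u₀` shows that `ev` absorbs the cocycle, so `v ↦ (ev v)⁻¹ • E(v)` is
  -- a genuine representation of `C`.
  have hmul (v) (hv : v ∈ C) (w) (hw : w ∈ C) : ev w * ev v = cocycle p v w * ev (v + w) := by
    have h1 := errorOp_mulVec_mulVec p v w u₀
    rw [h₀ w hw, Matrix.mulVec_smul, h₀ v hv, h₀ _ (C.add_mem hv hw), smul_smul, smul_smul] at h1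
    exact smul_left_injective ℂ hne h1
  have hcard : (Fintype.card C : ℂ) ≠ 0 := Nat.cast_ne_zero.mpr Fintype.card_ne_zero
  -- The average over this representation projects onto its fixed vectors, which are the elements of
  -- `Q`; the dimension is then read off the trace.
  let M : Matrix (Fin n → F) (Fin n → F) ℂ :=
    (Fintype.card C : ℂ)⁻¹ • ∑ v : C, (ev v)⁻¹ • errorOp p (v : J n → F)
  have hM (x) : M.mulVec x = (Fintype.card C : ℂ)⁻¹ •
      ∑ v : C, (ev v)⁻¹ • (errorOp p (v : J n → F)).mulVec x := by
    simp only [M, Matrix.smul_mulVec, Matrix.sum_mulVec]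
  have hproj : LinearMap.IsProj Q (Matrix.toLin' M) := by
    refine ⟨fun x => (h _).mpr fun w hw => ?_, fun x hx => ?_⟩
    · rw [Matrix.toLin'_apply, hM, Matrix.mulVec_smul, smul_comm, Matrix.mulVec_sum]
      congr 1
      rw [Finset.smul_sum, ← Equiv.sum_comp (Equiv.addLeft (⟨w, hw⟩ : C))
        (fun v : C => ev w • (ev v)⁻¹ • (errorOp p (v : J n → F)).mulVec x)]
      refine Finset.sum_congr rfl fun v _ => ?_
      rw [Matrix.mulVec_smul, errorOp_mulVec_mulVec, smul_smul, smul_smul, Equiv.coe_addLeft,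
        AddSubgroup.coe_add]
      congr 1
      have h1 := hmul w hw v v.2
      have h2 := hev v v.2
      have h3 := hev _ (C.add_mem hw v.2)
      field_simp
      rw [h1, mul_comm]
    · rw [Matrix.toLin'_apply, hM]
      have : ∀ v : C, (ev v)⁻¹ • (errorOp p (v : J n → F)).mulVec x = x := fun v => by
        rw [(h x).mp hx v v.2, smul_smul, inv_mul_cancel₀ (hev v v.2), one_smul]
      simp only [this, Finset.sum_const, Finset.card_univ]
      rw [← Nat.cast_smul_eq_nsmul ℂ, smul_smul, inv_mul_cancel₀ hcard, one_smul]
  have ht := hproj.trace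
  have hone : ev 0 = 1 := by
    have := h₀ 0 C.zero_mem
    rw [errorOp_zero, Matrix.one_mulVec] at this
    exact (smul_left_injective ℂ hne (by simpa using this)).symm
  rw [Matrix.trace_toLin'_eq, Matrix.trace_smul, Matrix.trace_sum,
    Finset.sum_eq_single (0 : C)] at ht
  · rw [Matrix.trace_smul, AddSubgroup.coe_zero, hone, trace_errorOp_zero, inv_one, one_smul,
      smul_eq_mul, inv_mul_eq_iff_eq_mul₀ hcard] at ht
    rw [Nat.card_eq_fintype_card, mul_comm]
    exact_mod_cast ht.symm
  · intro v _ hv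
    rw [Matrix.trace_smul, trace_errorOp p (fun h => hv (Subtype.ext h)), smul_zero]
  · simp

/-! ### Images of stabilizers in `F²ⁿ` -/

variable {p}

lemma mulVec_of_val_eq {s : Matrix (Fin n → F) (Fin n → F) ℂ} {c : ZMod p}
    {v : J n → F} (hs : s = omegaPow p c • errorOp p v) {u : (Fin n → F) → ℂ} {d : ℂ} :
    s.mulVec u = d • u ↔ (errorOp p v).mulVec u = ((omegaPow p c)⁻¹ * d) • u := by
  have hc := omegaPow_ne_zero p c
  rw [hs, Matrix.smul_mulVec, mul_smul, eq_inv_smul_iff₀ hc]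

lemma exists_val_mul_eq {s t : (Matrix (Fin n → F) (Fin n → F) ℂ)ˣ} {c d : ZMod p}
    {v w : J n → F} (hs : s.val = omegaPow p c • errorOp p v)
    (ht : t.val = omegaPow p d • errorOp p w) :
    ∃ e : ZMod p, (s * t).val = omegaPow p e • errorOp p (v + w) := by
  refine ⟨c + d + Algebra.trace (ZMod p) F (∑ i, v (Sum.inr i) * w (Sum.inl i)), ?_⟩
  rw [Units.val_mul, hs, ht, Matrix.smul_mul, Matrix.mul_smul, errorOp_mul, smul_smul,
    smul_smul, omegaPow_add, omegaPow_add, mul_assoc]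

lemma exists_val_inv_eq {s : (Matrix (Fin n → F) (Fin n → F) ℂ)ˣ} {c : ZMod p}
    {v : J n → F} (hs : s.val = omegaPow p c • errorOp p v) :
    ∃ e : ZMod p, (s⁻¹).val = omegaPow p e • errorOp p (-v) := by
  refine ⟨-c - Algebra.trace (ZMod p) F (∑ i, (-v) (Sum.inr i) * v (Sum.inl i)), ?_⟩
  refine Units.inv_eq_of_mul_eq_one_left ?_
  rw [hs, Matrix.smul_mul, Matrix.mul_smul, errorOp_mul, smul_smul, smul_smul,
    neg_add_cancel, errorOp_zero, ← omegaPow_add, ← omegaPow_add]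
  rw [show ∀ t : ZMod p, -c - t + c + t = 0 from fun t => by ring, omegaPow_zero, one_smul]

/-- Proportional error operators are equal. -/
lemma eq_of_smul_errorOp_eq {c d : ZMod p} {v w : J n → F}
    (h : omegaPow p c • errorOp p v = omegaPow p d • errorOp p w) : v = w := by
  by_contra hne
  -- Multiplying by `E(-v)` and taking traces makes the left side nonzero and the right side zero
  -- when `v ≠ w`.
  have h' := congrArg (fun A => (errorOp p (-v) * A).trace) h
  simp only [Matrix.mul_smul, errorOp_mul, Matrix.trace_smul, neg_add_cancel,
    trace_errorOp_zero] at h'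
  rw [trace_errorOp p (v := -v + w) (fun h => hne (neg_add_eq_zero.mp h)), smul_zero,
    smul_zero] at h'
  refine smul_ne_zero (omegaPow_ne_zero p c) (smul_ne_zero (omegaPow_ne_zero p _) ?_) h'
  exact pow_ne_zero _ (Nat.cast_ne_zero.mpr Fintype.card_ne_zero)

variable (p) in
/-- The image of a group of operators in `F²ⁿ`, as an additive subgroup. -/
noncomputable def stabImageAddSubgroup (S : Subgroup (Matrix (Fin n → F) (Fin n → F) ℂ)ˣ) :
    AddSubgroup (J n → F) where
  carrier := stabImage p S
  zero_mem' := ⟨1, S.one_mem, 0, by rw [omegaPow_zero, errorOp_zero, one_smul, Units.val_one]⟩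
  add_mem' := by
    rintro v w ⟨s, hs, c, hc⟩ ⟨t, ht, d, hd⟩
    exact ⟨s * t, S.mul_mem hs ht, exists_val_mul_eq hc hd⟩
  neg_mem' := by
    rintro v ⟨s, hs, c, hc⟩
    exact ⟨s⁻¹, S.inv_mem hs, exists_val_inv_eq hc⟩

variable {Q : Submodule ℂ ((Fin n → F) → ℂ)} {S : Subgroup (Matrix (Fin n → F) (Fin n → F) ℂ)ˣ}

lemma stabImageAddSubgroup_le (hS : IsStabilizer p S Q) :
    stabImageAddSubgroup p S ≤ scalarGroup p Q := by
  rintro v ⟨s, hs, c, hc⟩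
  obtain ⟨-, -, ev, hev⟩ := hS
  exact ⟨_, fun u hu => (mulVec_of_val_eq hc).mp ((hev u).mp hu s hs)⟩

/-- The stabilizer image already cuts out `Q`, and further elements of `scalarGroup` impose no new
condition on vectors of `Q`. -/
lemma IsStabilizer.finrank_mul_card (hQ : Q ≠ ⊥) (hS : IsStabilizer p S Q)
    {C : AddSubgroup (J n → F)} (h1 : stabImageAddSubgroup p S ≤ C) (h2 : C ≤ scalarGroup p Q) :
    Module.finrank ℂ Q * Nat.card C = Fintype.card F ^ n := by
  classical
  have hscalar (v : J n → F) : ∃ c : ℂ, v ∈ C → ∀ u ∈ Q, (errorOp p v).mulVec u = c • u := by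
    by_cases hv : v ∈ C
    · obtain ⟨c, hc⟩ := h2 hv
      exact ⟨c, fun _ => hc⟩
    · exact ⟨0, fun h => absurd h hv⟩
  choose μ hμ using hscalar
  refine QuantumSymplectic.finrank_mul_card p hQ C μ fun u => ⟨fun hu v hv => hμ v hv u hu, ?_⟩
  intro h
  obtain ⟨hP, -, ev, hev⟩ := hS
  obtain ⟨u₀, hu₀, hne⟩ := Submodule.exists_mem_ne_zero_of_ne_bot hQ
  refine (hev u).mpr fun s hs => ?_
  obtain ⟨c, v, hc⟩ := hP hs
  have hv : v ∈ C := h1 ⟨s, hs, c, hc⟩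
  rw [mulVec_of_val_eq hc, h v hv]
  congr 1
  -- The chosen scalar `μ v` and the eigenvalue `ev s`, corrected by the phase, agree because both
  -- are realized on the nonzero vector `u₀`.
  have h3 := (mulVec_of_val_eq hc).mp ((hev u₀).mp hu₀ s hs)
  rw [hμ v hv u₀ hu₀] at h3
  exact smul_left_injective ℂ hne h3

/-- The image of a stabilizer depends on the code only. -/
lemma IsStabilizer.stabImage_eq (hQ : Q ≠ ⊥) (hS : IsStabilizer p S Q) :
    stabImage p S = scalarGroup p Q := by
  have hle := stabImageAddSubgroup_le hS
  -- The dimension formula at both extremes, the image and `scalarGroup`, gives equal cardinalities.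
  have h1 := hS.finrank_mul_card hQ le_rfl hle
  have h2 := hS.finrank_mul_card hQ hle le_rfl
  have hpos : 0 < Module.finrank ℂ Q := by
    rw [Module.finrank_pos_iff]
    exact Submodule.nontrivial_iff_ne_bot.mpr hQ
  have h3 := Nat.eq_of_mul_eq_mul_left hpos (h2.trans h1.symm)
  exact congrArg SetLike.coe (AddSubgroup.eq_of_le_of_card_ge hle h3.le)

/-- Both products of `E(v)` and `E(w)` act on `Q` by the same product of scalars, and each is its
cocycle times `E(v + w)`, which acts by a nonzero scalar. -/
lemma cocycle_comm (hQ : Q ≠ ⊥) {v w : J n → F} (hv : v ∈ scalarGroup p Q)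
    (hw : w ∈ scalarGroup p Q) : cocycle p v w = cocycle p w v := by
  obtain ⟨c, hc⟩ := hv
  obtain ⟨d, hd⟩ := hw
  obtain ⟨e, he⟩ := (scalarGroup p Q).add_mem ⟨c, hc⟩ ⟨d, hd⟩
  obtain ⟨u, hu, hne⟩ := Submodule.exists_mem_ne_zero_of_ne_bot hQ
  have h1 := errorOp_mulVec_mulVec p v w u
  have h2 := errorOp_mulVec_mulVec p w v u
  have he := he u hu
  rw [hd u hu, Matrix.mulVec_smul, hc u hu, he, smul_smul, smul_smul] at h1
  rw [hc u hu, Matrix.mulVec_smul, hd u hu, add_comm w v, he, smul_smul, smul_smul] at h2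
  have h1 := smul_left_injective ℂ hne h1
  have h2 := smul_left_injective ℂ hne h2
  refine mul_right_cancel₀ (eigenvalue_ne_zero p hne he) ?_
  rw [← h1, ← h2, mul_comm]

/-- Symmetry of the cocycle only says that the trace of the symplectic form vanishes. Since `U` is
closed under scalars, `u` may be replaced by `b • u` for every `b`, and nondegeneracy of the trace
form removes the trace. -/
lemma isIsotropic_of_coe_eq_scalarGroup (hQ : Q ≠ ⊥) {U : Submodule F (J n → F)}
    (hU : (U : Set (J n → F)) = scalarGroup p Q) : IsIsotropic U := by
  intro u hu v hv
  by_contra hne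
  obtain ⟨b, hb⟩ := exists_trace_mul_ne_zero p hne
  have hmem {x} (hx : x ∈ U) : x ∈ scalarGroup p Q := by
    rw [← SetLike.mem_coe, ← hU]; exact hx
  have h := omegaPow_injective p (cocycle_comm hQ (hmem (U.smul_mem b hu)) (hmem hv))
  refine hb ?_
  rw [← sub_eq_zero, ← map_sub, ← neg_eq_zero, ← map_neg] at h
  rw [← h, sympForm]
  congr 1
  simp only [Pi.smul_apply, smul_eq_mul, sub_mul, Finset.sum_mul, neg_sub]
  congr 1 <;> exact Finset.sum_congr rfl fun i _ => by ring

/-- If `Q` is a CSS code, then the image of its stabilizers contains the `X`-parts of its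
elements. -/
lemma IsCSSCode.xPart_mem (hQ : Q ≠ ⊥) (hcss : IsCSSCode p Q) {v : J n → F}
    (hv : v ∈ scalarGroup p Q) : xPart v ∈ scalarGroup p Q := by
  obtain ⟨S, hS, hgen⟩ := hcss
  have himage := hS.stabImage_eq hQ
  -- The property is additive in the representing vector, so it passes from the generators to all of
  -- `S`; the representing vector is identified with the given `v` at the end.
  have hall : ∀ s ∈ S, ∃ (v : J n → F), (∃ c : ZMod p, s.val = omegaPow p c • errorOp p v) ∧
      xPart v ∈ scalarGroup p Q := by
    intro s hs
    rw [hgen] at hs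
    induction hs using Subgroup.closure_induction with
    | mem s hs =>
      obtain ⟨hsS, c, v, hc, hv⟩ := hs
      refine ⟨v, ⟨c, hc⟩, ?_⟩
      rcases hv with hv | hv
      · have hx : xPart v = v := by ext (i | i) <;> simp [xPart, hv]
        rw [hx, ← SetLike.mem_coe, ← himage]
        exact ⟨s, hsS, c, hc⟩
      · have hx : xPart v = 0 := by ext (i | i) <;> simp [xPart, hv]
        rw [hx]
        exact zero_mem _
    | one => exact ⟨0, ⟨0, by rw [omegaPow_zero, errorOp_zero, one_smul, Units.val_one]⟩,
        by rw [map_zero]; exact zero_mem _⟩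
    | mul s t _ _ ihs iht =>
      obtain ⟨v, ⟨c, hc⟩, hv⟩ := ihs
      obtain ⟨w, ⟨d, hd⟩, hw⟩ := iht
      exact ⟨v + w, exists_val_mul_eq hc hd, by rw [map_add]; exact add_mem hv hw⟩
    | inv s _ ih =>
      obtain ⟨v, ⟨c, hc⟩, hv⟩ := ih
      exact ⟨-v, exists_val_inv_eq hc, by rw [map_neg]; exact neg_mem hv⟩
  rw [← SetLike.mem_coe, ← himage] at hv
  obtain ⟨s, hs, c, hc⟩ := hv
  obtain ⟨w, ⟨d, hd⟩, hw⟩ := hall s hs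
  rwa [eq_of_smul_errorOp_eq (hc.symm.trans hd)]

end Stabilizer
end QuantumSymplectic

theorem mainTheorem1 (p : ℕ) [Fact p.Prime] (F : Type*) [Field F] [Fintype F] [DecidableEq F]
    [Algebra (ZMod p) F] (n k d : ℕ) (Q : Submodule ℂ ((Fin n → F) → ℂ))
    (hQ : QuantumSymplectic.IsQuantumCode p k d Q)
    (hlin : QuantumSymplectic.IsLinearStabilizerCode p Q) :
    ∃ 𝓜 : QuantumSymplectic.SymplecticMatroid n,
      𝓜.IsRepresentable F ∧ 𝓜.rank = n - k ∧
      (∀ S, QuantumSymplectic.IsStabilizer p S Q →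
        (∃ M : Matrix (Fin (n - k)) (QuantumSymplectic.J n) F,
          QuantumSymplectic.IsStabilizerMatrix p S M) ∧
        ∀ (r : ℕ) (M : Matrix (Fin r) (QuantumSymplectic.J n) F),
          QuantumSymplectic.IsStabilizerMatrix p S M → QuantumSymplectic.Represents M 𝓜) ∧
      (QuantumSymplectic.IsCSSCode p Q → 𝓜.IsHomogeneous) := by
  open QuantumSymplectic in
  obtain ⟨S₀, hS₀, U, hU⟩ := hlin
  have hcard := Fintype.one_lt_card (α := F)
  -- On the zero space every `E(v)` is a scalar, so nothing could be read off `scalarGroup`; a code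
  -- of dimension `q^k` is nonzero.
  have hne : Q ≠ ⊥ := by
    rintro rfl
    have h := hQ.1
    rw [finrank_bot] at h
    exact (pow_pos (zero_lt_one.trans hcard) k).ne h
  have hUQ : (U : Set (J n → F)) = scalarGroup p Q := hU.trans (hS₀.stabImage_eq hne)
  have hiso := isIsotropic_of_coe_eq_scalarGroup hne hUQ
  have hrank : Module.finrank F U = n - k := by
    have h := hS₀.finrank_mul_card hne (stabImageAddSubgroup_le hS₀) le_rfl
    have hc : Nat.card (scalarGroup p Q) = Fintype.card F ^ Module.finrank F U := by
      rw [← Nat.card_eq_fintype_card, ← Module.natCard_eq_pow_finrank]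
      exact Nat.card_congr (Equiv.setCongr hUQ.symm)
    rw [hQ.1, hc, ← pow_add] at h
    -- Comparing exponents gives `k + dim U = n`, so the natural subtraction `n - k` is not
    -- truncated.
    have := Nat.pow_right_injective hcard h
    omega
  let b : Module.Basis (Fin (n - k)) F U := Module.finBasisOfFinrankEq F U hrank
  let M : Matrix (Fin (n - k)) (J n) F := fun i => (b i : J n → F)
  have hMli : LinearIndependent F M.row :=
    b.linearIndependent.map' U.subtype (Submodule.ker_subtype U)
  have hMspan : Submodule.span F (Set.range M.row) = U := by
    have h : Set.range M.row = U.subtype '' Set.range b := by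
      rw [← Set.range_comp]; rfl
    rw [h, Submodule.span_image, b.span_eq, Submodule.map_top, Submodule.range_subtype]
  refine ⟨SymplecticMatroid.ofIsotropic U hiso, ⟨_, M, represents_ofIsotropic hMli hiso hMspan⟩,
    hrank, fun S hS => ⟨⟨M, hMli, ?_⟩, fun r M' hM' => ?_⟩, fun hcss => ?_⟩
  · rw [hMspan, hUQ, hS.stabImage_eq hne]
  · refine represents_ofIsotropic hM'.1 hiso (SetLike.coe_injective ?_)
    rw [hM'.2, hUQ, hS.stabImage_eq hne]
  · refine isHomogeneous_ofIsotropic hiso fun u hu => ?_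
    rw [← SetLike.mem_coe, hUQ] at hu ⊢
    exact hcss.xPart_mem hne hu
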